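/- Let $\Omega$ be a finite non-empty set and $\mathcal P(\Omega)$ the simplex of probability distributions on $\Omega$ with its usual topology; identify $\omega\in\Omega$ with the distribution concentrated on $\omega$. A game with outcomes in $\mathcal P(\Omega)$ is given by a prediction set $\Lambda\subseteq[0,\infty]^{\mathcal P(\Omega)}$. Let $\Lambda_\Omega\subseteq[0,\infty]^{\Omega}$ be the set of restrictions to $\Omega$ of the elements of $\Lambda$, and $\Sigma_{\Lambda_\Omega}=\{g\in[0,\infty]^\Omega:\exists\gamma\in\Lambda_\Omega,\ \gamma\le g\}$. Losses and exponentials take values in $[0,\infty]$ (with its usual topology), where $\exp(-\infty)=0$, $\exp(\infty)=\infty$, $\infty-\infty=-\infty$, $0\cdot\infty=0$. Let $c\ge 1$ and $\eta>0$. Suppose that $\Lambda$ has the relative exp-convexity property for $c$ and $\eta$: for all $\gamma_1,\gamma_2\in\Lambda$ and $p\in\mathcal P(\Omega)$, $$\exp\Bigl(\eta\bigl(\tfrac{\gamma_1(p)}{c}-\gamma_2(p)\bigr)\Bigr)\le\sum_{\omega\in\Omega}p(\omega)\exp\Bigl(\eta\bigl(\tfrac{\gamma_1(\omega)}{c}-\gamma_2(\omega)\bigr)\Bigr).$$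 Suppose that $\lambda\colon\mathcal P(\Omega)\to\Sigma_{\Lambda_\Omega}$ is such that, for every $g\in\Sigma_{\Lambda_\Omega}$, the function $q_g(\pi,\omega)=\exp\bigl(\eta(\lambda(\pi,\omega)/c-g(\omega))\bigr)$ is forecast-continuous (continuous in $\pi\in\mathcal P(\Omega)$ for each $\omega$) and has the supermartingale property ($\sum_{\omega}\pi(\omega)q_g(\pi,\omega)\le1$ for all $\pi\in\mathcal P(\Omega)$). Let $\sigma\colon\Sigma_{\Lambda_\Omega}\to\Lambda_\Omega$ satisfy $\sigma(g)\le g$ for all $g$, let $\sigma_\Omega\colon\Lambda_\Omega\to\Lambda$ satisfy $\sigma_\Omega(\gamma)|_\Omega=\gamma$ for all $\gamma$, let $\Theta$ be a countable set of experts, and let $P_0$ be a probability distribution on $\Theta$. At each step $n=1,2,\dots$ all experts $\theta\in\Theta$ announce $\gamma_n^\theta\in\Lambda$, then Learner announces $\gamma_n\in\Lambda$, then Reality announces $p_n\in\mathcal P(\Omega)$; put $L_N=\sum_{n=1}^N\gamma_n(p_n)$ and $L_N^\theta=\sum_{n=1}^N\gamma_n^\theta(p_n)$. Then there is a strategy for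 Learner that, whatever the moves of the experts and of Reality, guarantees for every $N$ and every $\theta\in\Theta$ $$L_N\le c\,L_N^\theta+\frac{c}{\eta}\ln\frac1{P_0(\theta)}$$ (with $\ln(1/0)=\infty$). Moreover, this strategy can be taken to be a variant of the Defensive Forecasting Algorithm with parameters $c,\eta,\lambda,P_0,\sigma,\sigma_\Omega$: at every step $N$ and for every history, its prediction is $\gamma_N=\sigma_\Omega(\sigma(\lambda(\pi_N,\cdot)))$ for some $\pi_N\in\mathcal P(\Omega)$ such that, for all $\omega\in\Omega$, $$\sum_{\theta\in\Theta}P_0(\theta)Q_{N-1}(\theta)\exp\Bigl(\eta\bigl(\tfrac{\lambda(\pi_N,\omega)}{c}-\gamma_N^\theta(\omega)\bigr)\Bigr)\le\sum_{\theta\in\Theta}P_0(\theta)Q_{N-1}(\theta),$$ where $Q_{N-1}(\theta)=\prod_{n=1}^{N-1}\exp\bigl(\eta(\gamma_n(p_n)/c-\gamma_n^\theta(p_n))\bigr)$. -/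

import Mathlib

open scoped ENNReal

noncomputable section

namespace ExpertAdvice

/-! ### Games and superpredictions -/

/-- The superpredictions of a game with prediction set `Λ` (a set of functions from outcomes to
`[0, ∞]`): the functions that dominate some prediction pointwise. -/
def superpredictions {X : Type*} (Λ : Set (X → ℝ≥0∞)) : Set (X → ℝ≥0∞) :=
  {g | ∃ γ ∈ Λ, γ ≤ g}

/-- `exp (η (x / c - y))` for losses `x, y ∈ [0, ∞]`, with values in `[0, ∞]`. The arithmetic is
that of `EReal`, where `∞ - ∞ = -∞`, and `EReal.exp (-∞) = 0`, `EReal.exp ∞ = ∞`; so for `c, η > 0`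
this is `exp (η x / c) * exp (-η y)` with `0 * ∞ = 0`. -/
def expRegret (c η : ℝ) (x y : ℝ≥0∞) : ℝ≥0∞ :=
  EReal.exp ((η : EReal) * ((x : EReal) / (c : EReal) - (y : EReal)))

/-! ### Functions on the simplex of distributions -/

section Simplex

variable {Ω : Type*} [Fintype Ω]

/-- The expectation of `f : Ω → [0, ∞]` under the distribution `π`
(outcomes of probability `0` do not contribute, as `0 * ∞ = 0`). -/
def expect (π : stdSimplex ℝ Ω) (f : Ω → ℝ≥0∞) : ℝ≥0∞ :=
  ∑ ω, ENNReal.ofReal (π ω) * f ω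

/-- The supermartingale property of `q : 𝒫(Ω) × Ω → [0, ∞]`. -/
def HasSupermartingaleProperty (q : stdSimplex ℝ Ω → Ω → ℝ≥0∞) : Prop :=
  ∀ π, expect π (q π) ≤ 1

/-- Forecast-continuity: `q` is continuous in the distribution for every fixed outcome
(with respect to the usual topology of `[0, ∞]`). -/
def ForecastContinuous (q : stdSimplex ℝ Ω → Ω → ℝ≥0∞) : Prop :=
  ∀ ω, Continuous fun π => q π ω

/-- The function `q_g (π, ω) = exp (η (λ (π, ω) / c - g ω))`. -/
def qFun (c η : ℝ) (lam : stdSimplex ℝ Ω → Ω → ℝ≥0∞) (g : Ω → ℝ≥0∞) :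
    stdSimplex ℝ Ω → Ω → ℝ≥0∞ :=
  fun π ω => expRegret c η (lam π ω) (g ω)

variable [DecidableEq Ω]

/-- The restriction of a prediction on `𝒫(Ω)` to `Ω`, where `ω` is identified with the
distribution concentrated on `ω`. -/
def restrict (γ : stdSimplex ℝ Ω → ℝ≥0∞) : Ω → ℝ≥0∞ :=
  fun ω => γ (stdSimplex.vertex ω)

/-- The prediction set `Λ_Ω` of the restricted game on `Ω`. -/
def restrictedPredictions (Λ : Set (stdSimplex ℝ Ω → ℝ≥0∞)) : Set (Ω → ℝ≥0∞) :=
  restrict '' Λ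

/-- The relative exp-convexity property of a prediction set on `𝒫(Ω)`. -/
def RelativelyExpConvex (Λ : Set (stdSimplex ℝ Ω → ℝ≥0∞)) (c η : ℝ) : Prop :=
  ∀ γ₁ ∈ Λ, ∀ γ₂ ∈ Λ, ∀ p : stdSimplex ℝ Ω,
    expRegret c η (γ₁ p) (γ₂ p) ≤
      expect p fun ω => expRegret c η (restrict γ₁ ω) (restrict γ₂ ω)

end Simplex

/-! ### The protocol of prediction with expert advice -/

section Protocol

variable {X Θ : Type*} {Λ : Set (X → ℝ≥0∞)}

/-- The moves made in one round: the predictions of all experts, the prediction of Learner, and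
the outcome announced by Reality. -/
structure Round (Θ : Type*) {X : Type*} (Λ : Set (X → ℝ≥0∞)) where
  experts : Θ → Λ
  learner : Λ
  outcome : X

/-- A strategy for Learner: a prediction for each sequence of completed rounds (in chronological
order) and each family of current expert predictions. -/
abbrev Strategy (Θ : Type*) {X : Type*} (Λ : Set (X → ℝ≥0∞)) :=
  List (Round Θ Λ) → (Θ → Λ) → Λ

/-- The first `N` rounds when Learner follows the strategy `S`, the experts announce
`e 0, e 1, …`, and Reality announces `p 0, p 1, …`. -/
def play (S : Strategy Θ Λ) (e : ℕ → Θ → Λ) (p : ℕ → X) : ℕ → List (Round Θ Λ)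
  | 0 => []
  | N + 1 => play S e p N ++ [⟨e N, S (play S e p N) (e N), p N⟩]

/-- Learner's cumulative loss. -/
def learnerLoss (h : List (Round Θ Λ)) : ℝ≥0∞ :=
  (h.map fun r => r.learner.1 r.outcome).sum

/-- The cumulative loss of the expert `θ`. -/
def expertLoss (h : List (Round Θ Λ)) (θ : Θ) : ℝ≥0∞ :=
  (h.map fun r => (r.experts θ).1 r.outcome).sum

/-- The product over the completed rounds of `exp (η (γ_n(p_n) / c - γ_n^θ(p_n)))`. -/
def weight (c η : ℝ) (h : List (Round Θ Λ)) (θ : Θ) : ℝ≥0∞ :=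
  (h.map fun r => expRegret c η (r.learner.1 r.outcome) ((r.experts θ).1 r.outcome)).prod

/-- The strategy `S` guarantees, at each step `N` and for all experts `θ`, the bound
`L_N ≤ c L_N^θ + (c / η) ln (1 / P₀ θ)` (with `ln (1 / 0) = ∞`), whatever the moves of the experts
and of Reality. -/
def GuaranteesBound (c η : ℝ) (P₀ : PMF Θ) (S : Strategy Θ Λ) : Prop :=
  ∀ (e : ℕ → Θ → Λ) (p : ℕ → X) (N : ℕ) (θ : Θ),
    (learnerLoss (play S e p N) : EReal) ≤
      (c : EReal) * (expertLoss (play S e p N) θ : EReal) +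
        ((c / η : ℝ) : EReal) * ENNReal.log ((P₀ θ)⁻¹)

end Protocol

/-! ### The Defensive Forecasting Algorithm for outcomes in the simplex -/

/-- `S` is a variant of the Defensive Forecasting Algorithm with parameters `c`, `η`, `λ`, `P₀`,
`σ`, `σ_Ω`: at every step it finds a distribution `π` for which the potential
`∑ θ, P₀ θ * weight θ` would not increase for any outcome `ω ∈ Ω` if Learner's loss were
`λ (π, ω)`, and announces `σ_Ω (σ (λ (π, ·)))`. -/
def IsDefensiveForecasting {Ω Θ : Type*} [Fintype Ω] [DecidableEq Ω]
    {Λ : Set (stdSimplex ℝ Ω → ℝ≥0∞)} (c η : ℝ)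
    (lam : stdSimplex ℝ Ω → superpredictions (restrictedPredictions Λ)) (P₀ : PMF Θ)
    (σ : superpredictions (restrictedPredictions Λ) → restrictedPredictions Λ)
    (σΩ : restrictedPredictions Λ → Λ) (S : Strategy Θ Λ) : Prop :=
  ∀ (h : List (Round Θ Λ)) (e : Θ → Λ), ∃ π : stdSimplex ℝ Ω,
    (∀ ω, ∑' θ, P₀ θ * weight c η h θ * expRegret c η ((lam π).1 ω) (restrict (e θ).1 ω) ≤
      ∑' θ, P₀ θ * weight c η h θ) ∧
    S h e = σΩ (σ (lam π))

end ExpertAdvice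

end

/-! ### Combinatorics: Scarf's lemma by a parity argument. -/

namespace Scarf

/-! The potential `∑' θ, P₀ θ * weight θ` starts at 1, and Learner plays so that it never grows.
Each of its terms is then at most 1, and taking logarithms gives the loss bound
(`loss_le_of_expRegret_le`).

Suppose that a distribution `π` keeps the potential from growing at every vertex `ω` when Learner's
loss is `λ(π, ω)`. Replacing this loss by the smaller `σ (λ π)` only helps, and relative
exp-convexity bounds the growth at any `p` by the `p`-average of the growth at the vertices. So one
`π` handles every move of Reality.

Such a `π` comes from Levin's lemma (`exists_forall_le_of_expect_le`): the mixture of the functions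
`q_g` has `π`-expectation at most the current potential `C`, so at each `π` some outcome of positive
probability has value at most `C`. This is the covering hypothesis of the KKM lemma for the sublevel
sets, and a common point of these sets is the required `π`. The KKM lemma is derived from Scarf's
lemma, applied to ever finer lattices in the simplex. -/

/-- A set `T` is dominant for the rank functions `r` if every element is, for some index `i`,
ranked by `r i` no higher than all the elements of `T`. -/
def Dominant {V I : Type*} (r : I → V → ℕ) (T : Finset V) : Prop :=
  ∀ v, ∃ i, ∀ t ∈ T, r i v ≤ r i t

section

variable {V I : Type*} {r : I → V → ℕ}

theorem Dominant.mono {T T' : Finset V} (h : Dominant r T') (hT : T ⊆ T') : Dominant r T :=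
  fun v => (h v).imp fun _ hi t ht => hi t (hT ht)

/-- If the rank minima `m i` of a dominant set `T` exhaust `T` and coincide at `a ≠ b`, then some
element can enter `T` and take over the index `a`. -/
theorem Dominant.exists_entering [Fintype V] [DecidableEq V] {T : Finset V} (hT : Dominant r T)
    {m : I → V} (hmT : ∀ i, m i ∈ T) (hm : ∀ i, ∀ t ∈ T, r i (m i) ≤ r i t)
    (hsurj : ∀ t ∈ T, ∃ i, m i = t) {a b : I} (hab : a ≠ b) (hmab : m a = m b)
    (hne : ∃ v, ∀ i, i ≠ a → r i (m i) < r i v) :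
    ∃ v, v ∉ T ∧ (∀ i, i ≠ a → r i (m i) < r i v) ∧ Dominant r (insert v T) ∧
      ∀ u, (∀ i, i ≠ a → r i (m i) < r i u) → r a u ≤ r a v := by
  classical
  obtain ⟨v, hv, hmax⟩ := Finset.exists_max_image
    (Finset.univ.filter fun v => ∀ i, i ≠ a → r i (m i) < r i v) (r a)
    (by obtain ⟨v, hv⟩ := hne; exact ⟨v, by simpa using hv⟩)
  simp only [Finset.mem_filter, Finset.mem_univ, true_and] at hv hmax
  refine ⟨v, fun hvT => ?_, hv, fun u => ?_, hmax⟩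
  · obtain ⟨j, rfl⟩ := hsurj v hvT
    by_cases hj : j = a
    · have := hv b hab.symm
      rw [hj, hmab] at this
      exact this.false
    · exact (hv j hj).false
  · by_cases hu : ∀ i, i ≠ a → r i (m i) < r i u
    · obtain ⟨i, hi⟩ := hT u
      have hia : i = a := by
        by_contra hia
        exact absurd (hi _ (hmT i)) (not_le.2 (hu i hia))
      subst hia
      refine ⟨i, fun t ht => ?_⟩
      rcases Finset.mem_insert.1 ht with rfl | ht
      · exact hmax u hu
      · exact hi t ht
    · push Not at hu
      obtain ⟨i, hia, hi⟩ := hu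
      refine ⟨i, fun t ht => ?_⟩
      rcases Finset.mem_insert.1 ht with rfl | ht
      · exact hi.trans (hv i hia).le
      · exact hi.trans (hm i t ht)

/-- An element which enters a dominant set `T` and takes over the index `a` exceeds all the other
rank minima of `T`, and is the greatest such element in the order of `a`. -/
theorem Dominant.entering_spec [DecidableEq V] (hr : ∀ i, Function.Injective (r i))
    {T : Finset V} {m : I → V} (hmT : ∀ i, m i ∈ T) (hm : ∀ i, ∀ t ∈ T, r i (m i) ≤ r i t)
    {a : I} (hinj : ∀ i j, i ≠ a → j ≠ a → m i = m j → i = j) {v : V} (hvT : v ∉ T)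
    (hv : Dominant r (insert v T)) (hva : r a v < r a (m a)) :
    (∀ i, i ≠ a → r i (m i) < r i v) ∧
      ∀ u, (∀ i, i ≠ a → r i (m i) < r i u) → r a u ≤ r a v := by
  constructor
  · intro i hia
    by_contra hlt
    have hlt : r i v < r i (m i) := lt_of_le_of_ne (not_lt.1 hlt) fun h =>
      hvT (hr i h ▸ hmT i)
    obtain ⟨k, hk⟩ := hv (m i)
    have hkv := hk v (Finset.mem_insert_self _ _)
    have hkm : m i = m k := hr k <| le_antisymm
      (hk _ (Finset.mem_insert_of_mem (hmT k))) (hm k _ (hmT i))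
    have hka : k ≠ a := by
      rintro rfl
      rw [hkm] at hkv
      exact absurd hkv (not_le.2 hva)
    obtain rfl := hinj i k hia hka hkm
    exact absurd hkv (not_le.2 hlt)
  · intro u hu
    obtain ⟨k, hk⟩ := hv u
    by_cases hka : k = a
    · subst hka
      exact hk v (Finset.mem_insert_self _ _)
    · exact absurd (hk _ (Finset.mem_insert_of_mem (hmT k))) (not_le.2 (hu k hka))

/-- A dominant set with one element less than there are indices can be extended by one element to
a dominant set in exactly two ways, unless it consists of extreme elements. -/
theorem Dominant.card_extensions [Fintype V] [DecidableEq V] [Fintype I]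
    (hr : ∀ i, Function.Injective (r i)) {e : I → V} {T : Finset V} (hT : Dominant r T)
    (hcard : T.card + 1 = Fintype.card I) {x : V} (hx : x ∈ T)
    (hxe : ∀ i j, i ≠ j → r i x < r i (e j))
    [DecidablePred fun v => v ∉ T ∧ Dominant r (insert v T)] :
    (Finset.univ.filter fun v => v ∉ T ∧ Dominant r (insert v T)).card = 2 := by
  classical
  have hex : ∀ i, ∃ s ∈ T, ∀ t ∈ T, r i s ≤ r i t := fun i =>
    Finset.exists_min_image T (r i) ⟨x, hx⟩
  choose m hmT hm using hex
  -- Dominance applied to a member of `T` makes it the minimum of some order. As `T` has one element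
  -- fewer than there are indices, `m` identifies exactly one pair of indices `a`, `b`.
  have hsurj : ∀ t ∈ T, ∃ i, m i = t := fun t ht => by
    obtain ⟨i, hi⟩ := hT t
    exact ⟨i, hr i (le_antisymm (hm i t ht) (hi _ (hmT i)))⟩
  have himage : ∀ s : Finset I, (∀ i, ∃ j ∈ s, m j = m i) → s.image m = T := fun s hs => by
    ext t
    simp only [Finset.mem_image]
    constructor
    · rintro ⟨i, -, rfl⟩
      exact hmT i
    · intro ht
      obtain ⟨i, rfl⟩ := hsurj t ht
      exact hs i
  have hninj : ¬ Function.Injective m := fun h => by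
    have h1 := himage Finset.univ fun i => ⟨i, Finset.mem_univ _, rfl⟩
    have h2 := Finset.card_image_of_injective Finset.univ h
    rw [h1, Finset.card_univ] at h2
    omega
  simp only [Function.Injective, not_forall] at hninj
  obtain ⟨a, b, hmab, hab⟩ := hninj
  replace hab : a ≠ b := hab
  have hinj : ∀ a b, a ≠ b → m a = m b → ∀ i j, i ≠ a → j ≠ a → m i = m j → i = j := by
    intro a b hab hmab i j hi hj hij
    have h1 := himage (Finset.univ.erase a) fun i => by
      by_cases hi : i = a
      · exact ⟨b, by simp [hab.symm], by rw [hi, hmab]⟩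
      · exact ⟨i, by simp [hi], rfl⟩
    have h2 : ((Finset.univ.erase a).image m).card = (Finset.univ.erase a).card := by
      rw [h1, Finset.card_erase_of_mem (Finset.mem_univ _), Finset.card_univ]
      omega
    exact Finset.card_image_iff.1 h2 (by simp [hi]) (by simp [hj]) hij
  have hne : ∀ a, ∃ v, ∀ i, i ≠ a → r i (m i) < r i v := fun a =>
    ⟨e a, fun i hi => (hm i x hx).trans_lt (hxe i a hi)⟩
  obtain ⟨va, hvaT, hva, hvaD, hvamax⟩ := hT.exists_entering hmT hm hsurj hab hmab (hne a)
  obtain ⟨vb, hvbT, hvb, hvbD, hvbmax⟩ :=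
    hT.exists_entering hmT hm hsurj hab.symm hmab.symm (hne b)
  -- A common value would exceed the minimum of `T` in every order, against dominance.
  have hvab : va ≠ vb := by
    rintro rfl
    obtain ⟨i, hi⟩ := hT va
    by_cases hia : i = a
    · subst hia
      exact absurd (hi _ (hmT i)) (not_le.2 (hvb i hab))
    · exact absurd (hi _ (hmT i)) (not_le.2 (hva i hia))
  rw [Finset.card_eq_two]
  refine ⟨va, vb, hvab, ?_⟩
  ext v
  simp only [Finset.mem_filter, Finset.mem_univ, true_and, Finset.mem_insert,
    Finset.mem_singleton]
  constructor
  · rintro ⟨hvT, hv⟩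
    obtain ⟨i, hi⟩ := hv v
    have hiv : r i v < r i (m i) :=
      lt_of_le_of_ne (hi _ (Finset.mem_insert_of_mem (hmT i))) fun h => hvT (hr i h ▸ hmT i)
    -- The entering `v` takes over the index `i`, so the old minimum `m i` must survive as the
    -- minimum of another index `k`. Thus `i` belongs to the colliding pair.
    obtain ⟨k, hk⟩ := hv (m i)
    have hkv := hk v (Finset.mem_insert_self _ _)
    have hkm : m i = m k := hr k <| le_antisymm
      (hk _ (Finset.mem_insert_of_mem (hmT k))) (hm k _ (hmT i))
    have hik : i ≠ k := by
      rintro rfl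
      exact absurd hkv (not_le.2 hiv)
    have hiab : i = a ∨ i = b := by
      by_contra h
      push Not at h
      by_cases hka : k = a
      · refine hik (hinj b a hab.symm hmab.symm i k h.2 ?_ hkm)
        rw [hka]
        exact hab
      · exact hik (hinj a b hab hmab i k h.1 hka hkm)
    rcases hiab with rfl | rfl
    · left
      obtain ⟨h1, h2⟩ := Dominant.entering_spec hr hmT hm (hinj i b hab hmab) hvT hv hiv
      exact hr i (le_antisymm (hvamax v h1) (h2 va hva))
    · right
      obtain ⟨h1, h2⟩ :=
        Dominant.entering_spec hr hmT hm (hinj i a hab.symm hmab.symm) hvT hv hiv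
      exact hr i (le_antisymm (hvbmax v h1) (h2 vb hvb))
  · rintro (rfl | rfl)
    · exact ⟨hvaT, hvaD⟩
    · exact ⟨hvbT, hvbD⟩

/-- In a set with as many elements as there are colours, the number of elements without which
exactly the colour `i₀` is missing is even, unless all the colours occur. -/
theorem even_card_erase_image [DecidableEq V] [Fintype I] [DecidableEq I] (c : V → I) (i₀ : I)
    {T : Finset V} (hcard : T.card = Fintype.card I) (hT : T.image c ≠ Finset.univ) :
    Even (T.filter fun v => (T.erase v).image c = Finset.univ.erase i₀).card := by
  rcases Finset.eq_empty_or_nonempty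
    (T.filter fun v => (T.erase v).image c = Finset.univ.erase i₀) with h | ⟨v, hv⟩
  · simp [h]
  have hinj : ∀ v ∈ T, (T.erase v).image c = Finset.univ.erase i₀ →
      Set.InjOn c (T.erase v : Finset V) := fun v hv h => by
    apply Finset.card_image_iff.1
    rw [h, Finset.card_erase_of_mem hv, Finset.card_erase_of_mem (Finset.mem_univ _), hcard,
      Finset.card_univ]
  rw [Finset.mem_filter] at hv
  obtain ⟨hvT, hv⟩ := hv
  have hins : insert (c v) ((T.erase v).image c) = T.image c := by
    rw [← Finset.image_insert, Finset.insert_erase hvT]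
  have hcv : c v ≠ i₀ := fun h => by
    rw [hv, h, Finset.insert_erase (Finset.mem_univ _)] at hins
    exact hT hins.symm
  -- The colour of `v` is repeated at one other element `w`, and erasing either twin leaves the same
  -- colours. No third element qualifies, since erasing it would leave both twins.
  have : c v ∈ (T.erase v).image c := by simp [hv, hcv]
  obtain ⟨w, hw, hcw⟩ := Finset.mem_image.1 this
  obtain ⟨hwv, hwT⟩ := Finset.mem_erase.1 hw
  have hTimage : T.image c = Finset.univ.erase i₀ := by
    rw [← hins, hv, Finset.insert_eq_self]
    simp [hcv]
  have : (T.filter fun v => (T.erase v).image c = Finset.univ.erase i₀) = {v, w} := by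
    ext u
    simp only [Finset.mem_filter, Finset.mem_insert, Finset.mem_singleton]
    constructor
    · rintro ⟨huT, hu⟩
      by_contra h
      push Not at h
      exact hwv (hinj u huT hu (by simp [hwT, h.2.symm]) (by simp [hvT, h.1.symm]) hcw)
    · intro h
      rcases h with h | h
      · exact h ▸ ⟨hvT, hv⟩
      · rw [h]
        refine ⟨hwT, ?_⟩
        rw [← hTimage]
        refine (Finset.image_subset_image (Finset.erase_subset _ _)).antisymm fun k hk => ?_
        obtain ⟨u, hu, rfl⟩ := Finset.mem_image.1 hk
        by_cases huw : u = w
        · rw [huw]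
          exact Finset.mem_image.2 ⟨v, by simp [hvT, hwv.symm], hcw.symm⟩
        · exact Finset.mem_image_of_mem c (by simp [hu, huw])
  rw [this, Finset.card_pair hwv.symm]
  exact even_two

/-- **Scarf's lemma**, for a finite set with an extreme element `e i` for each index `i`. -/
theorem exists_dominant_image_eq_univ [Fintype V] [DecidableEq V] [Fintype I] [DecidableEq I]
    (hr : ∀ i, Function.Injective (r i)) {e : I → V} (he : Function.Injective e)
    (hbot : ∀ i v, r i (e i) ≤ r i v)
    (htop : ∀ v, v ∉ Set.range e → ∀ i j, i ≠ j → r i v < r i (e j))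
    (hrange : ∃ v, v ∉ Set.range e) (c : V → I) (hc : ∀ i, c (e i) = i) (i₀ : I) :
    ∃ T : Finset V, Dominant r T ∧ T.image c = Finset.univ := by
  classical
  by_contra hcon
  push Not at hcon
  -- Incidences of doors and cells are counted twice. Without a cell of all colours, each cell
  -- contains an even number of doors. Each door lies in two cells, except the boundary door `B` of
  -- extreme elements, which lies in one: a contradiction modulo 2.
  set doors : Finset (Finset V) := Finset.univ.filter fun T =>
    Dominant r T ∧ T.card + 1 = Fintype.card I ∧ T.image c = Finset.univ.erase i₀ with hdoors
  set cells : Finset (Finset V) := Finset.univ.filter fun T =>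
    Dominant r T ∧ T.card = Fintype.card I with hcells
  have hcount := Finset.sum_card_bipartiteAbove_eq_sum_card_bipartiteBelow
    (s := doors) (t := cells) (fun T T' => T ⊆ T')
  have hI : 0 < Fintype.card I := Fintype.card_pos_iff.2 ⟨i₀⟩
  have hcell : ∀ T' ∈ cells, 2 ∣ (doors.bipartiteBelow (fun T T' => T ⊆ T') T').card := by
    intro T' hT'
    obtain ⟨hD, hcard⟩ := (Finset.mem_filter.1 hT').2
    rw [← even_iff_two_dvd]
    refine (congrArg Even ?_).mp (even_card_erase_image c i₀ hcard (hcon T' hD))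
    apply Finset.card_bij fun v _ => T'.erase v
    · intro v hv
      obtain ⟨hvT, hv⟩ := Finset.mem_filter.1 hv
      simp only [Finset.bipartiteBelow, hdoors, Finset.mem_filter, Finset.mem_univ, true_and]
      refine ⟨⟨hD.mono (Finset.erase_subset _ _), ?_, hv⟩, Finset.erase_subset _ _⟩
      rw [Finset.card_erase_of_mem hvT]
      omega
    · intro v hv w hw h
      exact Finset.erase_injOn T' (Finset.mem_filter.1 hv).1 (Finset.mem_filter.1 hw).1 h
    · intro T hT
      simp only [Finset.bipartiteBelow, hdoors, Finset.mem_filter, Finset.mem_univ,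
        true_and] at hT
      obtain ⟨⟨-, h1, h2⟩, h3⟩ := hT
      obtain ⟨v, hv⟩ := Finset.card_eq_one.1
        (show (T' \ T).card = 1 by rw [Finset.card_sdiff_of_subset h3]; omega)
      have hvT : v ∈ T' \ T := by simp [hv]
      rw [Finset.mem_sdiff] at hvT
      have hE : T'.erase v = T := by
        rw [← Finset.sdiff_singleton_eq_erase, ← hv, Finset.sdiff_sdiff_eq_self h3]
      exact ⟨v, by rw [Finset.mem_filter, hE]; exact ⟨hvT.1, h2⟩, hE⟩
  have hdoor : ∀ T ∈ doors, (cells.bipartiteAbove (fun T T' => T ⊆ T') T).card =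
      (Finset.univ.filter fun v => v ∉ T ∧ Dominant r (insert v T)).card := by
    intro T hT
    obtain ⟨hD, hcard, -⟩ := (Finset.mem_filter.1 hT).2
    symm
    apply Finset.card_bij fun v _ => insert v T
    · intro v hv
      obtain ⟨hvT, hv⟩ := (Finset.mem_filter.1 hv).2
      simp only [Finset.bipartiteAbove, hcells, Finset.mem_filter, Finset.mem_univ, true_and]
      exact ⟨⟨hv, by rw [Finset.card_insert_of_notMem hvT, hcard]⟩, Finset.subset_insert _ _⟩
    · intro v hv w hw h
      have hvT := (Finset.mem_filter.1 hv).2.1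
      have : v ∈ insert w T := h ▸ Finset.mem_insert_self v T
      exact (Finset.mem_insert.1 this).resolve_right hvT
    · intro T' hT'
      simp only [Finset.bipartiteAbove, hcells, Finset.mem_filter, Finset.mem_univ,
        true_and] at hT'
      obtain ⟨⟨h1, h2⟩, h3⟩ := hT'
      obtain ⟨v, hv⟩ := Finset.card_eq_one.1
        (show (T' \ T).card = 1 by rw [Finset.card_sdiff_of_subset h3]; omega)
      have hvT : v ∈ T' \ T := by simp [hv]
      rw [Finset.mem_sdiff] at hvT
      have hE : insert v T = T' := by
        rw [Finset.insert_eq, ← hv, Finset.sdiff_union_of_subset h3]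
      refine ⟨v, ?_, hE⟩
      simp only [Finset.mem_filter, Finset.mem_univ, true_and, hE]
      exact ⟨hvT.2, h1⟩
  obtain ⟨v₀, hv₀⟩ := hrange
  have hnot : ∀ v, v ∉ Set.range e → ∀ i, ¬ r i v ≤ r i (e i) := fun v hv i h =>
    hv ⟨i, hr i (le_antisymm (hbot i v) h)⟩
  set B : Finset V := (Finset.univ.erase i₀).image e with hB
  have hmemB : ∀ i, i ≠ i₀ → e i ∈ B := fun i hi => Finset.mem_image_of_mem e (by simp [hi])
  have hBmem : ∀ t ∈ B, ∃ j, j ≠ i₀ ∧ e j = t := by simp [hB]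
  have hBcard : B.card + 1 = Fintype.card I := by
    rw [hB, Finset.card_image_of_injective _ he, Finset.card_erase_of_mem (Finset.mem_univ _),
      Finset.card_univ]
    omega
  obtain ⟨w, hwe, hw⟩ := Finset.exists_max_image
    (Finset.univ.filter fun v => v ∉ Set.range e) (r i₀)
    ⟨v₀, Finset.mem_filter.2 ⟨Finset.mem_univ _, hv₀⟩⟩
  replace hwe := (Finset.mem_filter.1 hwe).2
  replace hw : ∀ v, v ∉ Set.range e → r i₀ v ≤ r i₀ w := fun v hv =>
    hw v (Finset.mem_filter.2 ⟨Finset.mem_univ _, hv⟩)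
  have hwB : w ∉ B := fun h => by
    obtain ⟨j, -, hj⟩ := hBmem w h
    exact hwe ⟨j, hj⟩
  have hBw : Dominant r (insert w B) := by
    intro v
    by_cases hv : v ∈ Set.range e
    · obtain ⟨j, rfl⟩ := hv
      exact ⟨j, fun t _ => hbot j t⟩
    · refine ⟨i₀, fun t ht => ?_⟩
      rcases Finset.mem_insert.1 ht with rfl | ht
      · exact hw v hv
      · obtain ⟨j, hj, rfl⟩ := hBmem t ht
        exact (htop v hv i₀ j hj.symm).le
  have hBdoor : B ∈ doors := by
    refine Finset.mem_filter.2 ⟨Finset.mem_univ _, hBw.mono (Finset.subset_insert _ _), hBcard, ?_⟩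
    rw [hB, Finset.image_image, show c ∘ e = id from funext hc, Finset.image_id]
  have hBone : (Finset.univ.filter fun v => v ∉ B ∧ Dominant r (insert v B)).card = 1 := by
    rw [Finset.card_eq_one]
    refine ⟨w, ?_⟩
    ext v
    simp only [Finset.mem_filter, Finset.mem_univ, true_and, Finset.mem_singleton]
    refine ⟨fun ⟨hvB, hv⟩ => ?_, fun h => h ▸ ⟨hwB, hBw⟩⟩
    by_cases hve : v ∈ Set.range e
    · obtain ⟨j, rfl⟩ := hve
      have hj : j = i₀ := by
        by_contra hj
        exact hvB (hmemB j hj)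
      -- Adding `e i₀` to `B` gives all the extreme elements. These are not dominant: in each order
      -- `i` the element `e i` lies strictly below `v₀`.
      obtain ⟨i, hi⟩ := hv v₀
      refine absurd (hi (e i) ?_) (hnot v₀ hv₀ i)
      by_cases hii : i = i₀
      · rw [hii, hj]
        exact Finset.mem_insert_self _ _
      · exact Finset.mem_insert_of_mem (hmemB i hii)
    · obtain ⟨i, hi⟩ := hv w
      have hii : i = i₀ := by
        by_contra hii
        exact hnot w hwe i (hi _ (Finset.mem_insert_of_mem (hmemB i hii)))
      rw [hii] at hi
      exact hr i₀ (le_antisymm (hw v hve) (hi v (Finset.mem_insert_self _ _)))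
  have htwo : ∀ T ∈ doors.erase B,
      2 ∣ (cells.bipartiteAbove (fun T T' => T ⊆ T') T).card := by
    intro T hT
    obtain ⟨hTB, hTd⟩ := Finset.mem_erase.1 hT
    rw [hdoor T hTd]
    obtain ⟨hD, hcard, himage⟩ := (Finset.mem_filter.1 hTd).2
    obtain ⟨x, hxT, hx⟩ : ∃ x ∈ T, x ∉ Set.range e := by
      by_contra h
      push Not at h
      refine hTB (Finset.eq_of_subset_of_card_le (fun t ht => ?_) (by omega))
      obtain ⟨j, rfl⟩ := h t ht
      have := Finset.mem_image_of_mem c ht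
      rw [himage, hc] at this
      exact hmemB j (Finset.ne_of_mem_erase this)
    rw [hD.card_extensions hr hcard hxT (htop x hx)]
  have h1 := Finset.dvd_sum hcell
  have h2 := Finset.dvd_sum htwo
  rw [← hcount, ← Finset.add_sum_erase _ _ hBdoor, hdoor B hBdoor, hBone] at h1
  omega

end

/-- **Scarf's lemma**: for every colouring of a finite set with a ranking for each colour, there
is a subset `σ` such that every element is ranked no higher than all elements of `σ` by one of the
rankings for the colours of `σ`. -/
theorem exists_dominant_image {X I : Type*} [Fintype X] [Nonempty X] [Fintype I] [DecidableEq I]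
    (r : I → X → ℕ) (hr : ∀ i, Function.Injective (r i)) (c : X → I) :
    ∃ σ : Finset X, ∀ x, ∃ i ∈ σ.image c, ∀ s ∈ σ, r i x ≤ r i s := by
  classical
  obtain ⟨x₀⟩ := ‹Nonempty X›
  obtain ⟨M, hM⟩ : ∃ M, ∀ i x, r i x < M := by
    refine ⟨∑ i, ∑ x, r i x + 1, fun i x => Nat.lt_succ_of_le ?_⟩
    exact (Finset.single_le_sum (f := r i) (fun _ _ => Nat.zero_le _) (Finset.mem_univ x)).trans
      (Finset.single_le_sum (f := fun i => ∑ x, r i x) (fun _ _ => Nat.zero_le _)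
        (Finset.mem_univ i))
  -- One extreme element is added per index: lowest in its own order (the shift by 1 frees rank 0)
  -- and above all of `X` in the other orders.
  let R : I → X ⊕ I → ℕ := fun i => Sum.elim (fun x => r i x + 1)
    fun j => if j = i then 0 else M + 1 + Fintype.equivFin I j
  have hR : ∀ i, Function.Injective (R i) := by
    rintro i (x | j) (y | k) h
    · simp only [R, Sum.elim_inl, Nat.add_right_cancel_iff] at h
      rw [hr i h]
    · simp only [R, Sum.elim_inl, Sum.elim_inr] at h
      have := hM i x
      split_ifs at h; all_goals omega
    · simp only [R, Sum.elim_inl, Sum.elim_inr] at h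
      have := hM i y
      split_ifs at h; all_goals omega
    · simp only [R, Sum.elim_inr] at h
      split_ifs at h with h1 h2 h2
      · rw [h1, h2]
      · omega
      · omega
      · rw [(Fintype.equivFin I).injective (Fin.ext (Nat.add_left_cancel h))]
  obtain ⟨T, hT, himage⟩ := exists_dominant_image_eq_univ hR (e := Sum.inr) Sum.inr_injective
    (by intro i v; simp [R])
    (by
      rintro (x | j) hv i k hik
      · have := hM i x
        simp only [R, Sum.elim_inl, Sum.elim_inr, if_neg hik.symm]
        omega
      · exact absurd ⟨j, rfl⟩ hv)
    ⟨Sum.inl x₀, by simp⟩ (Sum.elim c id) (fun _ => rfl) (c x₀)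
  refine ⟨Finset.univ.filter fun x => Sum.inl x ∈ T, fun x => ?_⟩
  obtain ⟨i, hi⟩ := hT (Sum.inl x)
  refine ⟨i, ?_, fun s hs => ?_⟩
  · have : i ∈ T.image (Sum.elim c id) := himage ▸ Finset.mem_univ i
    obtain ⟨y | j, ht, hy⟩ := Finset.mem_image.1 this
    · exact Finset.mem_image.2 ⟨y, by simpa using ht, hy⟩
    · obtain rfl : j = i := hy
      -- The extreme element of index `i` has rank 0 in order `i`, so it cannot be in `T`: the rank
      -- of `x` is positive.
      simpa [R] using hi _ ht
  · simpa [R] using hi (Sum.inl s) (by simpa using hs)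

end Scarf

/-! ### From lattice points to the Knaster–Kuratowski–Mazurkiewicz lemma. -/

namespace Scarf

open Filter Topology

variable {I : Type*} [Fintype I]

/-- For every colouring of the points with natural coordinates and sum `n`, there is a point `x` such
that each coordinate of `x` is small, or the corresponding colour occurs close to `x`. -/
theorem exists_lattice_point [DecidableEq I] [Nonempty I] (n : ℕ) (c : (I → ℕ) → I) :
    ∃ x : I → ℕ, ∑ i, x i = n ∧ ∀ i, x i ≤ Fintype.card I ∨
      ∃ y : I → ℕ, ∑ i, y i = n ∧ c y = i ∧
        ∀ j, y j ≤ x j + Fintype.card I ∧ x j ≤ y j + Fintype.card I := by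
  classical
  let X := {x // x ∈ Finset.piAntidiag (Finset.univ : Finset I) n}
  have hX : ∀ x : X, ∑ i, x.1 i = n := fun x => (Finset.mem_piAntidiag.1 x.2).1
  have hmk : ∀ x : I → ℕ, ∑ i, x i = n → x ∈ Finset.piAntidiag (Finset.univ : Finset I) n :=
    fun x hx => Finset.mem_piAntidiag.2 ⟨hx, fun i _ => Finset.mem_univ i⟩
  obtain ⟨i₁⟩ := ‹Nonempty I›
  have : Nonempty X := ⟨⟨Pi.single i₁ n, hmk _ (by simp)⟩⟩
  -- Order by the coordinate `i`, with ties broken by an enumeration of `X`.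
  let r : I → X → ℕ := fun i x => x.1 i * Fintype.card X + Fintype.equivFin X x
  have hmod : ∀ i x, r i x % Fintype.card X = Fintype.equivFin X x := fun i x => by
    simp only [r, Nat.mul_add_mod_self_right]
    exact Nat.mod_eq_of_lt (Fintype.equivFin X x).2
  have hdiv : ∀ i x, r i x / Fintype.card X = x.1 i := fun i x => by
    simp only [r]
    rw [mul_comm, Nat.mul_add_div Fintype.card_pos, Nat.div_eq_of_lt (Fintype.equivFin X x).2,
      add_zero]
  have hr : ∀ i, Function.Injective (r i) := fun i x y h => by
    apply (Fintype.equivFin X).injective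
    apply Fin.ext
    rw [← hmod i x, ← hmod i y, h]
  have hle : ∀ i x y, r i x ≤ r i y → x.1 i ≤ y.1 i := fun i x y h => by
    rw [← hdiv i x, ← hdiv i y]
    exact Nat.div_le_div_right h
  obtain ⟨σ, hσ⟩ := exists_dominant_image r hr fun x => c x.1
  have hne : σ.Nonempty := by
    obtain ⟨i, hi, -⟩ := hσ (Classical.arbitrary X)
    exact Finset.image_nonempty.1 ⟨i, hi⟩
  set C := σ.image fun x => c x.1
  have hmin : ∀ i, ∃ s ∈ σ, ∀ t ∈ σ, s.1 i ≤ t.1 i := fun i =>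
    Finset.exists_min_image σ (fun s => s.1 i) hne
  choose μ hμσ hμ using hmin
  set m : I → ℕ := fun i => if i ∈ C then (μ i).1 i else 0 with hm
  have hmσ : ∀ y ∈ σ, ∀ i, m i ≤ y.1 i := fun y hy i => by
    simp only [hm]
    split_ifs
    · exact hμ i y hy
    · exact Nat.zero_le _
  -- Otherwise some lattice point has all coordinates at least `m i + 1`, which contradicts
  -- dominance. Hence points of `σ` exceed the lower bound `m` by a total less than `Fintype.card
  -- I`, and so are close together.
  have hsum : n < ∑ i, (m i + 1) := by
    by_contra h
    push Not at h
    obtain ⟨d, hd⟩ := Nat.exists_eq_add_of_le h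
    obtain ⟨i, hiC, hi⟩ := hσ ⟨fun i => m i + 1 + if i = i₁ then d else 0, hmk _ (by
      rw [hd, Finset.sum_add_distrib (f := fun i => m i + 1)]
      simp)⟩
    have := hle _ _ _ (hi _ (hμσ i))
    simp only [hm, if_pos hiC] at this
    omega
  rw [Finset.sum_add_distrib, Finset.sum_const, Finset.card_univ, smul_eq_mul, mul_one] at hsum
  have hub : ∀ y ∈ σ, ∀ j, y.1 j ≤ m j + Fintype.card I := fun y hy j => by
    have h1 := hX y
    rw [← Finset.add_sum_erase _ _ (Finset.mem_univ j)] at h1 hsum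
    have h2 := Finset.sum_le_sum fun i (_ : i ∈ Finset.univ.erase j) => hmσ y hy i
    omega
  obtain ⟨x, hx⟩ := hne
  refine ⟨x.1, hX x, fun i => ?_⟩
  by_cases hi : i ∈ C
  · right
    obtain ⟨y, hy, hyi⟩ := Finset.mem_image.1 hi
    exact ⟨y.1, hX y, hyi, fun j =>
      ⟨(hub y hy j).trans (Nat.add_le_add_right (hmσ x hx j) _),
        (hub x hx j).trans (Nat.add_le_add_right (hmσ y hy j) _)⟩⟩
  · left
    simpa [hm, hi] using hub x hx i

/-- For every colouring of the simplex there are points `x` such that each coordinate of `x` is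
arbitrarily small, or the corresponding colour occurs arbitrarily close to `x`. -/
theorem exists_approx [Nonempty I] (c : stdSimplex ℝ I → I) {n : ℕ} (hn : 0 < n) :
    ∃ x : stdSimplex ℝ I, ∀ i, x i ≤ Fintype.card I / n ∨
      ∃ y : stdSimplex ℝ I, c y = i ∧ dist y x ≤ Fintype.card I / n := by
  classical
  have hn' : (0 : ℝ) < n := Nat.cast_pos.2 hn
  have hmem : ∀ x : I → ℕ, ∑ i, x i = n → (fun i => (x i : ℝ) / n) ∈ stdSimplex ℝ I :=
    fun x hx => ⟨fun i => by positivity, by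
      rw [← Finset.sum_div, ← Nat.cast_sum, hx, div_self hn'.ne']⟩
  obtain ⟨x, hx, h⟩ := exists_lattice_point n fun x =>
    if hx : ∑ i, x i = n then c ⟨_, hmem x hx⟩ else Classical.arbitrary I
  refine ⟨⟨_, hmem x hx⟩, fun i => (h i).imp (fun hi => ?_) ?_⟩
  · change (x i : ℝ) / n ≤ _
    gcongr
  · rintro ⟨y, hy, hyi, hyx⟩
    rw [dif_pos hy] at hyi
    refine ⟨⟨_, hmem y hy⟩, hyi, ?_⟩
    rw [Subtype.dist_eq]
    refine (dist_pi_le_iff (by positivity)).2 fun j => ?_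
    rw [Real.dist_eq, ← sub_div, abs_div, abs_of_pos hn']
    gcongr
    obtain ⟨h1, h2⟩ := hyx j
    rw [abs_le]
    constructor
    · have : (x j : ℝ) ≤ y j + Fintype.card I := by exact_mod_cast h2
      linarith
    · have : (y j : ℝ) ≤ x j + Fintype.card I := by exact_mod_cast h1
      linarith

/-- If closed sets `G i` cover the simplex, then some point belongs to all the sets `G i` for which
its coordinate `i` does not vanish. -/
theorem exists_mem_of_cover [Nonempty I] {G : I → Set (stdSimplex ℝ I)}
    (hG : ∀ i, IsClosed (G i)) (hcov : ∀ x, ∃ i, x ∈ G i) :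
    ∃ x : stdSimplex ℝ I, ∀ i, x i = 0 ∨ x ∈ G i := by
  choose c hc using hcov
  choose x hx using fun n : ℕ => exists_approx c n.succ_pos
  obtain ⟨p, -, hp⟩ := isCompact_univ.ultrafilter_le_nhds ((hyperfilter ℕ).map x) (by simp)
  have hxp : Tendsto x (hyperfilter ℕ : Filter ℕ) (𝓝 p) := hp
  have hδ : Tendsto (fun n : ℕ => (Fintype.card I : ℝ) / (n.succ : ℕ))
      (hyperfilter ℕ : Filter ℕ) (𝓝 0) :=
    ((tendsto_const_div_atTop_nhds_zero_nat (Fintype.card I : ℝ)).comp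
      (tendsto_add_atTop_nat 1)).mono_left Nat.hyperfilter_le_atTop
  refine ⟨p, fun i => ?_⟩
  -- An ultrafilter decides, for each `i`, which alternative holds eventually, so a single limit
  -- point serves all `i`.
  rcases Ultrafilter.eventually_or.1 (Eventually.of_forall fun n => hx n i) with h | h
  · left
    refine le_antisymm (le_of_tendsto_of_tendsto ?_ hδ h) (p.2.1 i)
    exact ((continuous_apply i).comp continuous_subtype_val).continuousAt.tendsto.comp hxp
  · right
    have hch : ∀ n, ∃ y : stdSimplex ℝ I,
        (∃ y : stdSimplex ℝ I, c y = i ∧ dist y (x n) ≤ Fintype.card I / (n.succ : ℕ)) →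
          c y = i ∧ dist y (x n) ≤ Fintype.card I / (n.succ : ℕ) := fun n => by
      by_cases hn : ∃ y : stdSimplex ℝ I,
        c y = i ∧ dist y (x n) ≤ Fintype.card I / (n.succ : ℕ)
      · exact ⟨hn.choose, fun _ => hn.choose_spec⟩
      · exact ⟨x n, fun h => absurd h hn⟩
    choose y hy using hch
    have hyx : Tendsto (fun n => dist (y n) (x n)) (hyperfilter ℕ : Filter ℕ) (𝓝 0) :=
      squeeze_zero' (Eventually.of_forall fun _ => dist_nonneg)
        (h.mono fun n hn => (hy n hn).2) hδ
    have hyp : Tendsto y (hyperfilter ℕ : Filter ℕ) (𝓝 p) :=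
      (tendsto_iff_of_dist hyx).2 hxp
    exact (hG i).mem_of_tendsto hyp (h.mono fun n hn => (hy n hn).1 ▸ hc (y n))

/-- The **Knaster–Kuratowski–Mazurkiewicz lemma**. -/
theorem exists_mem_iInter [Nonempty I] {F : I → Set (stdSimplex ℝ I)}
    (hF : ∀ i, IsClosed (F i)) (hcov : ∀ x : stdSimplex ℝ I, ∃ i, 0 < x i ∧ x ∈ F i) :
    ∃ x, ∀ i, x ∈ F i := by
  classical
  -- The vertex `i` lies in `F i`. Nonemptiness matters because `Metric.infDist` to the empty set is
  -- 0.
  have hne : ∀ i, (F i).Nonempty := fun i => by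
    obtain ⟨j, hj, h⟩ := hcov (stdSimplex.vertex i)
    by_cases hij : j = i
    · exact hij ▸ ⟨_, h⟩
    · exact absurd hj (by simp [stdSimplex.vertex, hij])
  set d : I → stdSimplex ℝ I → ℝ := fun i x => Metric.infDist x (F i)
  have hd0 : ∀ i x, 0 ≤ d i x := fun i x => Metric.infDist_nonneg
  have hdc : ∀ i, Continuous (d i) := fun i => Metric.continuous_infDist_pt _
  have hcoord : ∀ i, Continuous fun x : stdSimplex ℝ I => x i := fun i =>
    (continuous_apply i).comp continuous_subtype_val
  -- These sets cover because both sides have the same sum over `i`. For the same reason, all the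
  -- inequalities at the point found are equalities. A set `F i` containing it with `0 < x i` then
  -- forces the total distance to vanish.
  obtain ⟨x, hx⟩ := exists_mem_of_cover (G := fun i => {x | x i * ∑ j, d j x ≤ d i x})
    (fun i => isClosed_le ((hcoord i).mul (continuous_finsetSum _ fun j _ => hdc j)) (hdc i))
    fun x => by
      by_contra h
      simp only [Set.mem_ofPred_eq, not_exists, not_le] at h
      have := Finset.sum_lt_sum_of_nonempty Finset.univ_nonempty fun i _ => h i
      rw [← Finset.sum_mul, stdSimplex.sum_eq_one, one_mul] at this
      exact this.false
  have hle : ∀ i, x i * ∑ j, d j x ≤ d i x := fun i => by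
    rcases hx i with h | h
    · rw [h, zero_mul]
      exact hd0 i x
    · exact h
  have heq : ∀ i, x i * ∑ j, d j x = d i x := fun i =>
    (Finset.sum_eq_sum_iff_of_le fun i _ => hle i).1
      (by rw [← Finset.sum_mul, stdSimplex.sum_eq_one, one_mul]) i (Finset.mem_univ i)
  obtain ⟨i, hi, hiF⟩ := hcov x
  have hS : ∑ j, d j x = 0 := by
    have h0 : d i x = 0 := Metric.infDist_zero_of_mem hiF
    rw [← heq i] at h0
    exact (mul_eq_zero.1 h0).resolve_left hi.ne'
  refine ⟨x, fun j => ((hF j).mem_iff_infDist_zero (hne j)).2 ?_⟩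
  change d j x = 0
  rw [← heq j, hS, mul_zero]

end Scarf

/-! ### Exponential regrets, Levin's lemma and the potential. -/

namespace ExpertAdvice

theorem expRegret_mono {c η : ℝ} (hc : 0 ≤ c) (hη : 0 ≤ η) {x x' : ℝ≥0∞} (h : x ≤ x') (y : ℝ≥0∞) :
    expRegret c η x y ≤ expRegret c η x' y :=
  EReal.exp_monotone <| mul_le_mul_of_nonneg_left
    (EReal.sub_le_sub (EReal.div_le_div_right_of_nonneg (EReal.coe_nonneg.2 hc)
      (EReal.coe_ennreal_le_coe_ennreal_iff.2 h)) le_rfl) (EReal.coe_nonneg.2 hη)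

theorem expRegret_coe (c η : ℝ) (x y : NNReal) :
    expRegret c η x y = ENNReal.ofReal (Real.exp (η * (x / c - y))) := rfl

theorem expRegret_top_coe {c η : ℝ} (hc : 0 < c) (hη : 0 < η) (y : NNReal) :
    expRegret c η ∞ y = ∞ := by
  rw [expRegret, EReal.exp_eq_top_iff, EReal.coe_ennreal_top,
    EReal.top_div_of_pos_ne_top (EReal.coe_pos.2 hc) (EReal.coe_ne_top c)]
  change (η : EReal) * (⊤ - ((y : ℝ) : EReal)) = ⊤
  rw [EReal.top_sub_coe, EReal.coe_mul_top_of_pos hη]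

theorem expRegret_ne_zero {c η : ℝ} (hc : 0 < c) (hη : 0 < η) (x : ℝ≥0∞) (y : NNReal) :
    expRegret c η x y ≠ 0 := by
  induction x with
  | top => simp [expRegret_top_coe hc hη]
  | coe x => simp [expRegret_coe, Real.exp_pos]

theorem expRegret_mul {c η : ℝ} (hc : 0 < c) (hη : 0 < η) (x x' : ℝ≥0∞) {y y' : ℝ≥0∞}
    (hy : y ≠ ∞) (hy' : y' ≠ ∞) :
    expRegret c η x y * expRegret c η x' y' = expRegret c η (x + x') (y + y') := by
  lift y to NNReal using hy
  lift y' to NNReal using hy'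
  rw [← ENNReal.coe_add]
  induction x with
  | top => rw [top_add, expRegret_top_coe hc hη, expRegret_top_coe hc hη,
      ENNReal.top_mul (expRegret_ne_zero hc hη _ _)]
  | coe x =>
    induction x' with
    | top => rw [add_top, expRegret_top_coe hc hη, expRegret_top_coe hc hη,
        ENNReal.mul_top (expRegret_ne_zero hc hη _ _)]
    | coe x' =>
      rw [← ENNReal.coe_add, expRegret_coe, expRegret_coe, expRegret_coe,
        ← ENNReal.ofReal_mul (Real.exp_pos _).le, ← Real.exp_add]
      congr 2
      push_cast
      ring

section Potential

variable {X Θ : Type*} {Λ : Set (X → ℝ≥0∞)}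

/-- Exponentials turn the sum of regrets into a product. Experts of infinite loss can be left aside,
as the loss bound is trivial for them. -/
theorem weight_eq_expRegret {c η : ℝ} (hc : 0 < c) (hη : 0 < η) (h : List (Round Θ Λ)) (θ : Θ)
    (hθ : expertLoss h θ ≠ ∞) :
    weight c η h θ = expRegret c η (learnerLoss h) (expertLoss h θ) := by
  induction h with
  | nil => simp [weight, learnerLoss, expertLoss, expRegret]
  | cons a h ih =>
    have hsplit : expertLoss (a :: h) θ = (a.experts θ).1 a.outcome + expertLoss h θ := by
      simp [expertLoss]
    rw [hsplit, ENNReal.add_ne_top] at hθ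
    have hL : learnerLoss (a :: h) = a.learner.1 a.outcome + learnerLoss h := by
      simp [learnerLoss]
    have hW : weight c η (a :: h) θ =
        expRegret c η (a.learner.1 a.outcome) ((a.experts θ).1 a.outcome) * weight c η h θ := by
      simp [weight]
    rw [hsplit, hL, hW, ih hθ.2, expRegret_mul hc hη _ _ hθ.1 hθ.2]

theorem weight_append_singleton (c η : ℝ) (h : List (Round Θ Λ)) (a : Round Θ Λ) (θ : Θ) :
    weight c η (h ++ [a]) θ = weight c η h θ *
      expRegret c η (a.learner.1 a.outcome) ((a.experts θ).1 a.outcome) := by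
  simp [weight]

/-- A bound on the regret expressed through exponentials gives the bound on the loss. -/
theorem loss_le_of_expRegret_le {c η : ℝ} (hc : 0 < c) (hη : 0 < η) {L Lθ P : ℝ≥0∞} (hP : P ≤ 1)
    (h : Lθ ≠ ∞ → P * expRegret c η L Lθ ≤ 1) :
    (L : EReal) ≤ (c : EReal) * (Lθ : EReal) + ((c / η : ℝ) : EReal) * ENNReal.log P⁻¹ := by
  have hcη : 0 < c / η := div_pos hc hη
  have hlog : 0 ≤ ENNReal.log P⁻¹ := ENNReal.zero_le_log_iff.2 (ENNReal.one_le_inv.2 hP)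
  have hlog' : 0 ≤ ((c / η : ℝ) : EReal) * ENNReal.log P⁻¹ :=
    mul_nonneg (EReal.coe_nonneg.2 hcη.le) hlog
  have hcL : 0 ≤ (c : EReal) * (Lθ : EReal) :=
    mul_nonneg (EReal.coe_nonneg.2 hc.le) (EReal.coe_ennreal_nonneg _)
  by_cases hLθ : Lθ = ∞
  · rw [hLθ, EReal.coe_ennreal_top, EReal.coe_mul_top_of_pos hc,
      EReal.top_add_of_ne_bot (ne_of_gt (EReal.bot_lt_zero.trans_le hlog'))]
    exact le_top
  by_cases hP0 : P = 0
  · rw [hP0, ENNReal.inv_zero, ENNReal.log_top, EReal.coe_mul_top_of_pos hcη,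
      EReal.add_top_of_ne_bot (ne_of_gt (EReal.bot_lt_zero.trans_le hcL))]
    exact le_top
  have h := h hLθ
  have hPtop : P ≠ ∞ := ne_top_of_le_ne_top ENNReal.one_ne_top hP
  lift Lθ to NNReal using hLθ
  have hLtop : L ≠ ∞ := by
    rintro rfl
    rw [expRegret_top_coe hc hη, ENNReal.mul_top hP0] at h
    exact absurd h (by simp)
  lift L to NNReal using hLtop
  lift P to NNReal using hPtop
  have hPpos : (0 : ℝ) < P := NNReal.coe_pos.2 (pos_iff_ne_zero.2 (by simpa using hP0))
  have hreal : (P : ℝ) * Real.exp (η * (L / c - Lθ)) ≤ 1 := by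
    rw [expRegret_coe, ← ENNReal.ofReal_coe_nnreal, ← ENNReal.ofReal_mul hPpos.le,
      ENNReal.ofReal_le_one] at h
    exact h
  have hle : η * (L / c - Lθ) ≤ -Real.log P := by
    have := Real.log_le_log (by positivity) hreal
    rw [Real.log_mul hPpos.ne' (Real.exp_ne_zero _), Real.log_exp, Real.log_one] at this
    linarith
  have hfin : (L : ℝ) ≤ c * Lθ + c / η * -Real.log P := by
    have h1 := mul_le_mul_of_nonneg_left hle hcη.le
    have h2 : c / η * (η * (L / c - Lθ)) = (L : ℝ) - c * Lθ := by
      field_simp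
    linarith
  rw [ENNReal.log_inv, ← ENNReal.ofReal_coe_nnreal (p := P), ENNReal.log_ofReal_of_pos hPpos]
  change ((L : ℝ) : EReal) ≤ (c : EReal) * ((Lθ : ℝ) : EReal) + _
  exact_mod_cast hfin

end Potential

section Simplex

variable {Ω : Type*} [Fintype Ω]

theorem expect_tsum {Θ : Type*} (π : stdSimplex ℝ Ω) (a : Θ → ℝ≥0∞) (f : Θ → Ω → ℝ≥0∞) :
    expect π (fun ω => ∑' θ, a θ * f θ ω) = ∑' θ, a θ * expect π (f θ) := by
  simp only [expect, ← ENNReal.tsum_mul_left, Finset.mul_sum]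
  rw [Summable.tsum_finsetSum fun _ _ => ENNReal.summable]
  exact Finset.sum_congr rfl fun ω _ => tsum_congr fun θ => mul_left_comm _ _ _

theorem expect_mono (π : stdSimplex ℝ Ω) {f g : Ω → ℝ≥0∞} (h : ∀ ω, f ω ≤ g ω) :
    expect π f ≤ expect π g :=
  Finset.sum_le_sum fun ω _ => mul_le_mul_right (h ω) _

theorem expect_const (π : stdSimplex ℝ Ω) (C : ℝ≥0∞) : expect π (fun _ => C) = C := by
  rw [expect, ← Finset.sum_mul, ← ENNReal.ofReal_sum_of_nonneg fun ω _ => stdSimplex.zero_le π ω,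
    stdSimplex.sum_eq_one, ENNReal.ofReal_one, one_mul]

/-- **Levin's lemma**: if `q` is lower semicontinuous in the distribution and has expectation at
most `C` under every distribution, then for some distribution all its values are at most `C`. -/
theorem exists_forall_le_of_expect_le [Nonempty Ω] {q : stdSimplex ℝ Ω → Ω → ℝ≥0∞}
    (hq : ∀ ω, LowerSemicontinuous fun π => q π ω) {C : ℝ≥0∞}
    (h : ∀ π, expect π (q π) ≤ C) : ∃ π, ∀ ω, q π ω ≤ C := by
  refine Scarf.exists_mem_iInter (F := fun ω => {π | q π ω ≤ C})
    (fun ω => (hq ω).isClosed_preimage C) fun π => ?_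
  by_contra hcon
  simp only [Set.mem_ofPred_eq, not_exists, not_and, not_le] at hcon
  have hpos : ∃ ω, 0 < π ω := by
    by_contra hπ
    push Not at hπ
    have := Finset.sum_nonpos fun ω (_ : ω ∈ Finset.univ) => hπ ω
    rw [stdSimplex.sum_eq_one] at this
    linarith
  -- The values are known to exceed `C` only on the support of `π`, so the expectations are compared
  -- there.
  have hrestrict : ∀ f : Ω → ℝ≥0∞, ∑ ω with 0 < π ω, ENNReal.ofReal (π ω) * f ω = expect π f :=
    fun f => Finset.sum_filter_of_ne fun ω _ hω => by
      by_contra hπ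
      exact hω (by rw [ENNReal.ofReal_of_nonpos (not_lt.1 hπ), zero_mul])
  have hlt : ∑ ω with 0 < π ω, ENNReal.ofReal (π ω) * C <
      ∑ ω with 0 < π ω, ENNReal.ofReal (π ω) * q π ω := by
    refine ENNReal.sum_lt_sum_of_nonempty ?_ fun ω hω => ?_
    · obtain ⟨ω, hω⟩ := hpos
      exact ⟨ω, by simpa using hω⟩
    · have hω := (Finset.mem_filter.1 hω).2
      exact ENNReal.mul_lt_mul_right (ENNReal.ofReal_pos.2 hω).ne' ENNReal.ofReal_ne_top
        (hcon ω hω)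
  rw [hrestrict fun _ => C, expect_const, hrestrict] at hlt
  exact absurd (h π) (not_le.2 hlt)

/-- The step of the Defensive Forecasting Algorithm: a mixture of forecast-continuous functions
with the supermartingale property does not exceed its initial value at some distribution. -/
theorem exists_forall_tsum_le [Nonempty Ω] {Θ : Type*} (a : Θ → ℝ≥0∞)
    {q : Θ → stdSimplex ℝ Ω → Ω → ℝ≥0∞} (hcont : ∀ θ, ForecastContinuous (q θ))
    (hsuper : ∀ θ, HasSupermartingaleProperty (q θ)) :
    ∃ π, ∀ ω, ∑' θ, a θ * q θ π ω ≤ ∑' θ, a θ := by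
  by_cases hC : ∑' θ, a θ = ∞
  · exact ⟨Classical.arbitrary _, fun ω => hC ▸ le_top⟩
  -- An infinite sum of continuous nonnegative functions need only be lower semicontinuous, which
  -- suffices for closed sublevel sets. Finite coefficients keep each term continuous.
  refine exists_forall_le_of_expect_le (fun ω => lowerSemicontinuous_tsum fun θ => ?_) fun π => ?_
  · exact ((ENNReal.continuous_const_mul (ENNReal.ne_top_of_tsum_ne_top hC θ)).comp
      (hcont θ ω)).lowerSemicontinuous
  · rw [expect_tsum π a fun θ => q θ π]
    exact ENNReal.tsum_le_tsum fun θ => mul_le_of_le_one_right' (hsuper θ π)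

variable [DecidableEq Ω]

/-- The potential does not increase under the Defensive Forecasting Algorithm. -/
theorem IsDefensiveForecasting.tsum_weight_play_le {Θ : Type*} {Λ : Set (stdSimplex ℝ Ω → ℝ≥0∞)}
    {c η : ℝ} (hc : 0 ≤ c) (hη : 0 ≤ η) (hΛ : RelativelyExpConvex Λ c η)
    {lam : stdSimplex ℝ Ω → superpredictions (restrictedPredictions Λ)} {P₀ : PMF Θ}
    {σ : superpredictions (restrictedPredictions Λ) → restrictedPredictions Λ}
    (hσ : ∀ g, (σ g).1 ≤ g.1) {σΩ : restrictedPredictions Λ → Λ}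
    (hσΩ : ∀ γ, restrict (σΩ γ).1 = γ.1) {S : Strategy Θ Λ}
    (hS : IsDefensiveForecasting c η lam P₀ σ σΩ S) (e : ℕ → Θ → Λ) (p : ℕ → stdSimplex ℝ Ω)
    (N : ℕ) : ∑' θ, P₀ θ * weight c η (play S e p N) θ ≤ 1 := by
  induction N with
  | zero => simp [play, weight, P₀.tsum_coe]
  | succ N ih =>
    obtain ⟨π, hπ, hSπ⟩ := hS (play S e p N) (e N)
    calc ∑' θ, P₀ θ * weight c η (play S e p (N + 1)) θ
        = ∑' θ, P₀ θ * weight c η (play S e p N) θ *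
            expRegret c η ((S (play S e p N) (e N)).1 (p N)) ((e N θ).1 (p N)) :=
          tsum_congr fun θ => by rw [play, weight_append_singleton, mul_assoc]
      _ ≤ ∑' θ, P₀ θ * weight c η (play S e p N) θ *
            expect (p N) fun ω => expRegret c η ((lam π).1 ω) (restrict (e N θ).1 ω) := by
          refine ENNReal.tsum_le_tsum fun θ => mul_le_mul_right ?_ _
          -- Relative exp-convexity passes from `p N` to the vertices, where Learner's loss is `σ
          -- (lam π)`, at most `lam π`.
          refine (hΛ _ (Subtype.prop _) _ (Subtype.prop _) _).trans (expect_mono _ fun ω => ?_)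
          rw [hSπ, hσΩ]
          exact expRegret_mono hc hη (hσ _ ω) _
      _ = expect (p N) fun ω => ∑' θ, P₀ θ * weight c η (play S e p N) θ *
            expRegret c η ((lam π).1 ω) (restrict (e N θ).1 ω) := (expect_tsum _ _ _).symm
      _ ≤ expect (p N) fun _ => ∑' θ, P₀ θ * weight c η (play S e p N) θ := expect_mono _ hπ
      _ ≤ 1 := by rwa [expect_const]

end Simplex

end ExpertAdvice

theorem mainTheorem9 {Ω Θ : Type*} [Fintype Ω] [DecidableEq Ω] [Nonempty Ω] [Countable Θ]
    (Λ : Set (stdSimplex ℝ Ω → ℝ≥0∞)) (c η : ℝ) (hc : 1 ≤ c) (hη : 0 < η)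
    (hΛ : ExpertAdvice.RelativelyExpConvex Λ c η)
    (lam : stdSimplex ℝ Ω →
      ExpertAdvice.superpredictions (ExpertAdvice.restrictedPredictions Λ))
    (hcont : ∀ g ∈ ExpertAdvice.superpredictions (ExpertAdvice.restrictedPredictions Λ),
      ExpertAdvice.ForecastContinuous (ExpertAdvice.qFun c η (fun π => (lam π).1) g))
    (hsuper : ∀ g ∈ ExpertAdvice.superpredictions (ExpertAdvice.restrictedPredictions Λ),
      ExpertAdvice.HasSupermartingaleProperty (ExpertAdvice.qFun c η (fun π => (lam π).1) g))
    (σ : ExpertAdvice.superpredictions (ExpertAdvice.restrictedPredictions Λ) →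
      ExpertAdvice.restrictedPredictions Λ)
    (hσ : ∀ g, (σ g).1 ≤ g.1)
    (σΩ : ExpertAdvice.restrictedPredictions Λ → Λ)
    (hσΩ : ∀ γ, ExpertAdvice.restrict (σΩ γ).1 = γ.1)
    (P₀ : PMF Θ) :
    ∃ S : ExpertAdvice.Strategy Θ Λ,
      ExpertAdvice.IsDefensiveForecasting c η lam P₀ σ σΩ S ∧
        ExpertAdvice.GuaranteesBound c η P₀ S := by

  have hc0 : 0 < c := zero_lt_one.trans_le hc
  have hmem : ∀ γ : Λ, ExpertAdvice.restrict γ.1 ∈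
      ExpertAdvice.superpredictions (ExpertAdvice.restrictedPredictions Λ) := fun γ =>
    ⟨_, ⟨γ.1, γ.2, rfl⟩, le_rfl⟩
  choose π hπ using fun (h : List (ExpertAdvice.Round Θ Λ)) (e : Θ → Λ) =>
    ExpertAdvice.exists_forall_tsum_le (fun θ => P₀ θ * ExpertAdvice.weight c η h θ)
      (fun θ => hcont _ (hmem (e θ))) (fun θ => hsuper _ (hmem (e θ)))
  have hS : ExpertAdvice.IsDefensiveForecasting c η lam P₀ σ σΩ
      fun h e => σΩ (σ (lam (π h e))) := fun h e => ⟨π h e, hπ h e, rfl⟩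
  refine ⟨_, hS, fun e p N θ => ?_⟩
  refine ExpertAdvice.loss_le_of_expRegret_le hc0 hη (P₀.coe_le_one θ) fun hθ => ?_
  rw [← ExpertAdvice.weight_eq_expRegret hc0 hη _ _ hθ]
  exact (ENNReal.le_tsum θ).trans (hS.tsum_weight_play_le hc0.le hη.le hΛ hσ hσΩ e p N)
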